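/- Let $G$ be a finite connected simple undirected graph of order $n\ge 2$, and let $\lambda$ be an eigenvalue of its adjacency matrix, with multiplicity $m_G(\lambda)$. Let $\gamma(G)$ be the domination number of $G$, i.e. the minimum size of a set $S\subseteq V(G)$ such that every vertex of $V(G)\setminus S$ is adjacent to some vertex of $S$, and let $\gamma_t(G)$ be the total domination number of $G$, i.e. the minimum size of a set $S\subseteq V(G)$ such that every vertex of $V(G)$ is adjacent to some vertex of $S$. Then $$\gamma(G)\le n-m_G(\lambda),$$ and $\gamma(G)=n-m_G(\lambda)$ if and only if, up to isomorphism of $G$, $$(\lambda,G)\in\{(1,K_2),\ (-1,K_n),\ (0,K_{r,s}) : r,s\ge 2\}.$$ Moreover, if $G$ is not isomorphic to the complete graph $K_n$, then $\gamma_t(G)\le n-m_G(\lambda)$. Here $K_{r,s}$ denotes the complete bipartite graph with part sizes $r$ and $s$. -/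

import Mathlib

namespace SimpleGraph

/-- `S` is a dominating set: every vertex outside `S` is adjacent to some vertex in `S`. -/
def IsDominatingSet {V : Type*} (G : SimpleGraph V) (S : Finset V) : Prop :=
  ∀ v, v ∉ S → ∃ w ∈ S, G.Adj v w

/-- `S` is a total dominating set: every vertex is adjacent to some vertex in `S`. -/
def IsTotalDominatingSet {V : Type*} (G : SimpleGraph V) (S : Finset V) : Prop :=
  ∀ v, ∃ w ∈ S, G.Adj v w

/-- The domination number: the minimum size of a dominating set (attained, since the set of all
vertices is dominating). -/
noncomputable def dominationNumber {V : Type*} [Fintype V] (G : SimpleGraph V) : ℕ :=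
  sInf {k : ℕ | ∃ S : Finset V, G.IsDominatingSet S ∧ S.card = k}

/-- The total domination number: the minimum size of a total dominating set, which is `⊤` if there
is no such set. -/
noncomputable def totalDominationNumber {V : Type*} [Fintype V] (G : SimpleGraph V) : ℕ∞ :=
  ⨅ S : {S : Finset V // G.IsTotalDominatingSet S}, (S.1.card : ℕ∞)

/-- `μ` is an adjacency eigenvalue of `G`. -/
def IsAdjEigenvalue {V : Type*} [Fintype V] [DecidableEq V] (G : SimpleGraph V)
    [DecidableRel G.Adj] (μ : ℝ) : Prop :=
  Module.End.HasEigenvalue (Matrix.toLin' (G.adjMatrix ℝ)) μ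

/-- The multiplicity of `μ` as an adjacency eigenvalue of `G`, i.e. the dimension of its eigenspace
(the algebraic and geometric multiplicities agree, as the adjacency matrix is symmetric). -/
noncomputable def adjMultiplicity {V : Type*} [Fintype V] [DecidableEq V] (G : SimpleGraph V)
    [DecidableRel G.Adj] (μ : ℝ) : ℕ :=
  Module.finrank ℝ (Module.End.eigenspace (Matrix.toLin' (G.adjMatrix ℝ)) μ)

/-- A multiplicity is at most the order of the graph, so that `n - m` in `ℕ` never truncates. -/
theorem adjMultiplicity_le_card {V : Type*} [Fintype V] [DecidableEq V] (G : SimpleGraph V)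
    [DecidableRel G.Adj] (μ : ℝ) : G.adjMultiplicity μ ≤ Fintype.card V := by
  have h := Submodule.finrank_le
    (Module.End.eigenspace (Matrix.toLin' (G.adjMatrix ℝ)) μ)
  simpa [adjMultiplicity] using h

end SimpleGraph

/-!
Write `M = A - μ I`, so that `n - m_G(μ)` is the rank of `M`. Let `S` be a set of vertices whose
rows span the row space of `M`. A vertex outside `S` without neighbour in `S` has a column that
vanishes on `S`, hence vanishes altogether, so it is isolated; therefore `S` is dominating in a
connected graph (`IsRowSpanning.isDominatingSet`).

If `G` is not complete, some edge has independent rows, and a maximal connected set with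
independent rows containing it is a basis of the row space: the vertices whose rows are in its span
have no neighbour outside (`exists_connected_row_basis`). Such a basis has at least two vertices
and is connected, so it is a total dominating set of size `rank M`. This gives both inequalities. If `G` is complete, `γ(G) = 1 ≤ rank M`, and
`rank M = 1` makes any two rows proportional with factor `-μ = ±1` (`eq_of_rank_eq_one`).

If `G` is not complete and `γ(G) = rank M`, this basis `S` is a minimum dominating set without
isolated vertices, so every `s ∈ S` has a private neighbour `p s` outside `S`. The columns of the vertices `p s`
restrict to the standard basis on `S`, which gives `M w v = ∑ s ∈ S, M s v * M w (p s)` for all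
`v, w` (`IsRowSpanning.shiftedAdj_eq_sum`). In particular the matrices `A[S] - μ` and `A[p S] - μ` are
mutually inverse. The diagonal of their product says `μ ^ 2 + k = 1` with a count `k`, so
`μ ∈ {0, 1, -1}`. For `μ = -1` the off-diagonal entries exclude edges in `S`. For `μ = 1` there are
`s, t ∈ S` with `p s` adjacent to `p t`, and `(S \ {s, t}) ∪ {p s}` is a smaller dominating set
(`IsPrivateNeighbourMap.dominationNumber_lt`). For `μ = 0`, two 0-1 matrices are
mutually inverse, so `S` induces a connected perfect matching, that is, an edge, and
`rank M = 2` forces `G` to be complete bipartite (`IsPrivateNeighbourMap.adj_iff_of_pair`).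
-/

namespace SimpleGraph

open Matrix Submodule

variable {V : Type*} {G : SimpleGraph V}

/-! ### Connectivity -/

/-- In a preconnected graph, a property of one vertex that passes along edges holds everywhere. -/
theorem Preconnected.forall_of_adj (h : G.Preconnected) {P : V → Prop} {a : V} (ha : P a)
    (hstep : ∀ u v, G.Adj u v → P u → P v) (v : V) : P v := by
  obtain ⟨p⟩ := h a v
  induction p with
  | nil => exact ha
  | cons e _ ih => exact ih (hstep _ _ e ha)

theorem Connected.induce_insert {S : Set V} {a b : V} (hS : (G.induce S).Connected)
    (ha : a ∈ S) (hab : G.Adj a b) : (G.induce (insert b S)).Connected := by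
  have h := induce_union_connected hS.preconnected
    (induce_pair_connected_of_adj hab).preconnected ⟨a, ha, by simp⟩
  have hset : S ∪ {a, b} = insert b S := by
    ext x
    simp only [Set.mem_union, Set.mem_insert_iff, Set.mem_singleton_iff]
    grind
  rw [hset] at h
  exact h

theorem Connected.exists_adj_mem {S : Finset V} (hS : (G.induce (S : Set V)).Connected)
    (hcard : 2 ≤ S.card) {s : V} (hs : s ∈ S) : ∃ t ∈ S, G.Adj s t := by
  have : Nontrivial ↑(S : Set V) := by
    rw [Set.nontrivial_coe_sort]
    exact Finset.one_lt_card_iff_nontrivial.mp hcard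
  obtain ⟨t, ht⟩ := hS.preconnected.exists_adj_of_nontrivial ⟨s, hs⟩
  exact ⟨t, t.2, ht⟩

/-! ### Domination numbers -/

theorem dominationNumber_le [Fintype V] {S : Finset V} (hS : G.IsDominatingSet S) :
    G.dominationNumber ≤ S.card :=
  Nat.sInf_le ⟨S, hS, rfl⟩

theorem exists_isDominatingSet_card_eq [Fintype V] (G : SimpleGraph V) :
    ∃ S : Finset V, G.IsDominatingSet S ∧ S.card = G.dominationNumber :=
  Nat.sInf_mem (s := {k : ℕ | ∃ S : Finset V, G.IsDominatingSet S ∧ S.card = k})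
    ⟨_, Finset.univ, fun v hv => absurd (Finset.mem_univ v) hv, rfl⟩

theorem dominationNumber_pos [Fintype V] [Nonempty V] : 1 ≤ G.dominationNumber := by
  obtain ⟨S, hS, hcard⟩ := exists_isDominatingSet_card_eq G
  rw [← hcard, Nat.one_le_iff_ne_zero, Finset.card_ne_zero]
  let v := Classical.arbitrary V
  by_cases hv : v ∈ S
  · exact ⟨v, hv⟩
  · obtain ⟨w, hw, -⟩ := hS v hv
    exact ⟨w, hw⟩

theorem two_le_dominationNumber [Fintype V] [Nonempty V]
    (h : ∀ v, ∃ w, w ≠ v ∧ ¬ G.Adj w v) : 2 ≤ G.dominationNumber := by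
  obtain ⟨S, hS, hcard⟩ := exists_isDominatingSet_card_eq G
  by_contra hlt
  have hone : S.card = 1 := by
    have := dominationNumber_pos (G := G)
    omega
  obtain ⟨v, rfl⟩ := Finset.card_eq_one.mp hone
  obtain ⟨w, hwv, hadj⟩ := h v
  obtain ⟨x, hx, hwx⟩ := hS w (by simpa using hwv)
  rw [Finset.mem_singleton.mp hx] at hwx
  exact hadj hwx

theorem totalDominationNumber_le [Fintype V] {S : Finset V} (hS : G.IsTotalDominatingSet S) :
    G.totalDominationNumber ≤ S.card :=
  iInf_le (fun S : {S : Finset V // G.IsTotalDominatingSet S} => (S.1.card : ℕ∞)) ⟨S, hS⟩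

theorem dominationNumber_eq_one_of_eq_top [Fintype V] [Nonempty V] (h : G = ⊤) :
    G.dominationNumber = 1 := by
  refine le_antisymm ?_ dominationNumber_pos
  let v := Classical.arbitrary V
  have : G.IsDominatingSet {v} := fun w hw =>
    ⟨v, by simp, by rw [h]; simpa using hw⟩
  simpa using dominationNumber_le this

/-- In a dominating set without isolated vertices which has the minimum cardinality, every vertex
has a private neighbour outside the set. -/
theorem exists_private_neighbour [Fintype V] [DecidableEq V] {S : Finset V}
    (hS : G.IsTotalDominatingSet S) (hcard : S.card ≤ G.dominationNumber) {s : V} (hs : s ∈ S) :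
    ∃ u, u ∉ S ∧ ∀ t ∈ S, G.Adj t u ↔ t = s := by
  have hnot : ¬ G.IsDominatingSet (S.erase s) := fun h => by
    have h1 := dominationNumber_le h
    rw [Finset.card_erase_of_mem hs] at h1
    have := Finset.card_pos.mpr ⟨s, hs⟩
    omega
  simp only [IsDominatingSet, not_forall, not_exists, not_and, Finset.mem_erase] at hnot
  obtain ⟨u, hu, hnbr⟩ := hnot
  obtain ⟨w, hw, huw⟩ := hS u
  have hws : w = s := by
    by_contra hne
    exact hnbr w ⟨hne, hw⟩ huw
  subst hws
  refine ⟨u, fun huS => hu huw.ne huS, fun t ht => ⟨fun htu => ?_, fun h => h ▸ huw.symm⟩⟩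
  by_contra hne
  exact hnbr t ⟨hne, ht⟩ htu.symm

/-- For every `s ∈ S`, the vertex `p s` lies outside `S` and its only neighbour in `S` is `s`. -/
def IsPrivateNeighbourMap (G : SimpleGraph V) (S : Finset V) (p : V → V) : Prop :=
  ∀ s ∈ S, p s ∉ S ∧ ∀ t ∈ S, G.Adj t (p s) ↔ t = s

theorem IsTotalDominatingSet.exists_isPrivateNeighbourMap [Fintype V] [DecidableEq V]
    {S : Finset V} (hS : G.IsTotalDominatingSet S)
    (hcard : S.card ≤ G.dominationNumber) :
    ∃ p : V → V, G.IsPrivateNeighbourMap S p := by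
  choose! p hp using fun s (hs : s ∈ S) => exists_private_neighbour hS hcard hs
  exact ⟨p, hp⟩

theorem IsPrivateNeighbourMap.ne {S : Finset V} {p : V → V}
    (hp : G.IsPrivateNeighbourMap S p) {s t : V} (hs : s ∈ S) (ht : t ∈ S)
    (hne : s ≠ t) : p s ≠ p t := fun h =>
  hne (((hp t ht).2 s hs).mp (h ▸ ((hp s hs).2 s hs).mpr rfl))

theorem IsPrivateNeighbourMap.adj {S : Finset V} {p : V → V}
    (hp : G.IsPrivateNeighbourMap S p) {s : V} (hs : s ∈ S) : G.Adj s (p s) :=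
  ((hp s hs).2 s hs).mpr rfl

/-! ### The shifted adjacency matrix and its row space -/

theorem dotProduct_eq_zero_of_mem_span [Fintype V] {S : Set V} {M : Matrix V V ℝ} {z w : V → ℝ}
    (hz : ∀ s ∈ S, M.row s ⬝ᵥ z = 0) (hw : w ∈ span ℝ (M.row '' S)) : w ⬝ᵥ z = 0 := by
  induction hw using Submodule.span_induction with
  | mem x hx => obtain ⟨s, hs, rfl⟩ := hx; exact hz s hs
  | zero => simp
  | add x y _ _ hx hy => rw [add_dotProduct, hx, hy, add_zero]
  | smul a x _ hx => rw [smul_dotProduct, hx, smul_zero]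

section Shifted

variable [DecidableEq V] [DecidableRel G.Adj] {μ : ℝ}

/-- The matrix `A - μ I`, where `A` is the adjacency matrix of `G`. -/
def shiftedAdj (G : SimpleGraph V) [DecidableRel G.Adj] (μ : ℝ) : Matrix V V ℝ :=
  G.adjMatrix ℝ - μ • (1 : Matrix V V ℝ)

theorem shiftedAdj_self (v : V) : G.shiftedAdj μ v v = -μ := by
  simp [shiftedAdj]

theorem shiftedAdj_of_adj {u v : V} (h : G.Adj u v) : G.shiftedAdj μ u v = 1 := by
  simp [shiftedAdj, h, Matrix.one_apply_ne h.ne]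

theorem shiftedAdj_of_ne_of_not_adj {u v : V} (hne : u ≠ v) (h : ¬ G.Adj u v) :
    G.shiftedAdj μ u v = 0 := by
  simp [shiftedAdj, h, Matrix.one_apply_ne hne]

theorem shiftedAdj_comm (u v : V) : G.shiftedAdj μ u v = G.shiftedAdj μ v u := by
  simp [shiftedAdj, G.adj_comm u v, Matrix.one_apply, eq_comm]

theorem shiftedAdj_nonneg_of_ne {u v : V} (hne : u ≠ v) : 0 ≤ G.shiftedAdj μ u v := by
  by_cases h : G.Adj u v
  · simp [shiftedAdj_of_adj h]
  · simp [shiftedAdj_of_ne_of_not_adj hne h]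

theorem adj_of_shiftedAdj_ne_zero {u v : V} (hne : u ≠ v) (h : G.shiftedAdj μ u v ≠ 0) :
    G.Adj u v := by
  by_contra hadj
  exact h (shiftedAdj_of_ne_of_not_adj hne hadj)

theorem shiftedAdj_row_ne_zero {u v : V} (h : G.Adj u v) : (G.shiftedAdj μ).row u ≠ 0 := by
  intro h0
  have := congrFun h0 v
  rw [Matrix.row_apply, shiftedAdj_of_adj h] at this
  exact one_ne_zero this

/-- If the rows of two adjacent vertices are dependent, they are proportional with factor `-μ`,
and the principal minor `μ ^ 2 - 1` vanishes. -/
theorem row_eq_of_not_linearIndepOn_pair {a b : V} (hab : G.Adj a b)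
    (h : ¬ LinearIndepOn ℝ (G.shiftedAdj μ).row {a, b}) :
    (G.shiftedAdj μ).row b = (-μ) • (G.shiftedAdj μ).row a ∧ μ ^ 2 = 1 := by
  rw [linearIndepOn_pair_iff _ hab.ne (shiftedAdj_row_ne_zero hab)] at h
  push Not at h
  obtain ⟨c, hc⟩ := h
  have h1 := congrFun hc b
  have h2 := congrFun hc a
  simp only [Pi.smul_apply, Matrix.row_apply, shiftedAdj_self, shiftedAdj_of_adj hab,
    shiftedAdj_of_adj hab.symm, smul_eq_mul, mul_one] at h1 h2
  subst h1
  exact ⟨hc.symm, by nlinarith⟩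

theorem eq_top_of_forall_not_linearIndepOn (hG : G.Connected)
    (h : ∀ a b, G.Adj a b → ¬ LinearIndepOn ℝ (G.shiftedAdj μ).row {a, b}) : G = ⊤ := by
  ext u v
  simp only [top_adj]
  refine ⟨fun h => h.ne, fun hne => ?_⟩
  have : Nontrivial V := ⟨u, v, hne⟩
  obtain ⟨w, hw⟩ := hG.preconnected.exists_adj_of_nontrivial u
  have hμ : μ ≠ 0 := by
    intro h0
    have := (row_eq_of_not_linearIndepOn_pair hw (h u w hw)).2
    simp [h0] at this
  -- Along edges a row is scaled by the nonzero factor `-μ`, so column `v` has no zero entry.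
  have hent : G.shiftedAdj μ u v ≠ 0 := by
    refine hG.preconnected.forall_of_adj (P := fun x => G.shiftedAdj μ x v ≠ 0) (a := v)
      (by simpa [shiftedAdj_self] using hμ) (fun x y hxy hx => ?_) u
    have := congrFun (row_eq_of_not_linearIndepOn_pair hxy (h x y hxy)).1 v
    simp only [Pi.smul_apply, Matrix.row_apply, smul_eq_mul] at this
    rw [this]
    exact mul_ne_zero (neg_ne_zero.mpr hμ) hx
  exact adj_of_shiftedAdj_ne_zero hne hent

theorem IsPrivateNeighbourMap.shiftedAdj_eq {S : Finset V} {p : V → V}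
    (hp : G.IsPrivateNeighbourMap S p) {s t : V} (hs : s ∈ S) (ht : t ∈ S) :
    G.shiftedAdj μ t (p s) = if t = s then 1 else 0 := by
  split_ifs with h
  · exact shiftedAdj_of_adj (((hp s hs).2 t ht).mpr h)
  · exact shiftedAdj_of_ne_of_not_adj (fun he => (hp s hs).1 (he ▸ ht))
      (fun hadj => h (((hp s hs).2 t ht).mp hadj))

theorem IsPrivateNeighbourMap.shiftedAdj_mul_nonneg {S : Finset V} {p : V → V}
    (hp : G.IsPrivateNeighbourMap S p) {s t t' : V} (hs : s ∈ S) (ht' : t' ∈ S) (hst : s ≠ t)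
    (hst' : s ≠ t') : 0 ≤ G.shiftedAdj μ s t * G.shiftedAdj μ (p t') (p s) :=
  mul_nonneg (shiftedAdj_nonneg_of_ne hst) (shiftedAdj_nonneg_of_ne (hp.ne ht' hs hst'.symm))

/-- The rows of `A - μ I` indexed by `S` span its row space. -/
def IsRowSpanning (G : SimpleGraph V) [DecidableRel G.Adj] (μ : ℝ) (S : Finset V) : Prop :=
  ∀ v, (G.shiftedAdj μ).row v ∈ span ℝ ((G.shiftedAdj μ).row '' S)

variable [Fintype V]

theorem card_sub_adjMultiplicity (μ : ℝ) :
    Fintype.card V - G.adjMultiplicity μ = (G.shiftedAdj μ).rank := by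
  have hker : Module.End.eigenspace (Matrix.toLin' (G.adjMatrix ℝ)) μ =
      LinearMap.ker (G.shiftedAdj μ).mulVecLin := by
    ext x
    simp [shiftedAdj, sub_eq_zero]
  have h := LinearMap.finrank_range_add_finrank_ker (G.shiftedAdj μ).mulVecLin
  rw [Module.finrank_fintype_fun_eq_card] at h
  rw [adjMultiplicity, hker, Matrix.rank]
  omega

theorem IsRowSpanning.rank_le {S : Finset V} (hS : G.IsRowSpanning μ S) :
    (G.shiftedAdj μ).rank ≤ S.card := by
  rw [Matrix.rank_eq_finrank_span_row]
  have hle : span ℝ (Set.range (G.shiftedAdj μ).row) ≤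
      span ℝ ((S.image (G.shiftedAdj μ).row : Finset (V → ℝ)) : Set (V → ℝ)) := by
    rw [span_le, Finset.coe_image]
    rintro _ ⟨v, rfl⟩
    exact hS v
  exact (Submodule.finrank_mono hle).trans
    ((finrank_span_finset_le_card _).trans Finset.card_image_le)

theorem card_le_rank_of_linearIndepOn {S : Finset V}
    (hS : LinearIndepOn ℝ (G.shiftedAdj μ).row (S : Set V)) :
    S.card ≤ (G.shiftedAdj μ).rank := by
  rw [Matrix.rank_eq_finrank_span_row]
  have h := finrank_span_eq_card hS
  have hcard : Fintype.card ↑(S : Set V) = S.card := by simp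
  rw [← hcard, ← h]
  refine Submodule.finrank_mono (span_mono ?_)
  rintro _ ⟨s, rfl⟩
  exact ⟨s, rfl⟩

/-- If `u` lies outside `S` and has no neighbour in `S`, the column of `u` in `A - μ I` vanishes on
`S`, hence on every row in the span of the rows in `S`. -/
theorem shiftedAdj_eq_zero_of_mem_span {S : Finset V} {u v : V} (huS : u ∉ S)
    (hu : ∀ s ∈ S, ¬ G.Adj s u)
    (hv : (G.shiftedAdj μ).row v ∈ span ℝ ((G.shiftedAdj μ).row '' S)) :
    G.shiftedAdj μ v u = 0 := by
  have h := dotProduct_eq_zero_of_mem_span (z := Pi.single u 1) (fun s hs => ?_) hv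
  · simpa using h
  · have hne : s ≠ u := fun h => huS (h ▸ hs)
    simp [shiftedAdj_of_ne_of_not_adj hne (hu s hs)]

theorem IsRowSpanning.isDominatingSet {S : Finset V} (hS : G.IsRowSpanning μ S)
    (hiso : ∀ v, ∃ w, G.Adj v w) : G.IsDominatingSet S := by
  intro u hu
  by_contra! h
  obtain ⟨w, hw⟩ := hiso u
  have h0 := shiftedAdj_eq_zero_of_mem_span hu (fun s hs hsu => h s hs hsu.symm) (hS w)
  rw [shiftedAdj_of_adj hw.symm] at h0
  exact one_ne_zero h0

/-- If the vertices `p s` restrict the columns of `A - μ I` on a spanning set `S` of rows to the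
standard basis, every column is the combination of the columns `p s` prescribed by its
restriction to `S`. -/
theorem IsRowSpanning.shiftedAdj_eq_sum {S : Finset V} (hS : G.IsRowSpanning μ S) {p : V → V}
    (hp : ∀ s ∈ S, ∀ t ∈ S, G.shiftedAdj μ t (p s) = if t = s then 1 else 0) (v w : V) :
    G.shiftedAdj μ w v = ∑ s ∈ S, G.shiftedAdj μ s v * G.shiftedAdj μ w (p s) := by
  set z : V → ℝ := Pi.single v 1 - ∑ s ∈ S, G.shiftedAdj μ s v • Pi.single (p s) 1 with hzdef
  have hdot : ∀ x, (G.shiftedAdj μ).row x ⬝ᵥ z =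
      G.shiftedAdj μ x v - ∑ s ∈ S, G.shiftedAdj μ s v * G.shiftedAdj μ x (p s) := by
    intro x
    simp [hzdef, dotProduct_sub, dotProduct_sum, dotProduct_smul]
  have h := dotProduct_eq_zero_of_mem_span (z := z) (fun t ht => ?_) (hS w)
  · rw [hdot, sub_eq_zero] at h
    exact h
  · rw [hdot, Finset.sum_congr rfl (fun s hs => by rw [hp s hs t ht])]
    simp [show t ∈ S from ht]

/-! ### Connected bases of the row space -/

/-- A connected graph which is not complete has a basis of the row space of `A - μ I` consisting
of at least two vertices which induce a connected subgraph. -/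
theorem exists_connected_row_basis (hG : G.Connected) (htop : G ≠ ⊤) (μ : ℝ) :
    ∃ S : Finset V, 2 ≤ S.card ∧ (G.induce (S : Set V)).Connected ∧
      LinearIndepOn ℝ (G.shiftedAdj μ).row (S : Set V) ∧ G.IsRowSpanning μ S := by
  obtain ⟨a, b, hab, hind⟩ : ∃ a b, G.Adj a b ∧
      LinearIndepOn ℝ (G.shiftedAdj μ).row {a, b} := by
    by_contra! hcon
    exact htop (eq_top_of_forall_not_linearIndepOn hG hcon)
  obtain ⟨S, hle, hmax⟩ := Finite.exists_le_maximal
    (p := fun S : Finset V => (G.induce (S : Set V)).Connected ∧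
      LinearIndepOn ℝ (G.shiftedAdj μ).row (S : Set V)) (a := {a, b})
    (by rw [Finset.coe_pair]; exact ⟨induce_pair_connected_of_adj hab, hind⟩)
  have haS : a ∈ S := hle (by simp)
  refine ⟨S, ?_, hmax.prop.1, hmax.prop.2, ?_⟩
  · rw [← Finset.card_pair hab.ne]
    exact Finset.card_le_card hle
  · refine fun v => hG.preconnected.forall_of_adj
      (P := fun v => (G.shiftedAdj μ).row v ∈ span ℝ ((G.shiftedAdj μ).row '' S)) (a := a)
      (subset_span ⟨a, haS, rfl⟩) (fun x y hxy hx => ?_) v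
    by_contra hy
    have hyS : y ∉ S := fun h => hy (subset_span ⟨y, h, rfl⟩)
    -- By maximality `y` has no neighbour in `S`, so column `y` vanishes on the row of `x`.
    have hnbr : ∀ s ∈ S, ¬ G.Adj s y := by
      intro s hs hsy
      have hins := hmax.le_of_ge (y := insert y S)
        (by
          rw [Finset.coe_insert]
          exact ⟨hmax.prop.1.induce_insert hs hsy, hmax.prop.2.insert hy⟩)
        (Finset.subset_insert y S)
      exact hyS (hins (Finset.mem_insert_self y S))
    have h0 := shiftedAdj_eq_zero_of_mem_span hyS hnbr hx
    rw [shiftedAdj_of_adj hxy] at h0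
    exact one_ne_zero h0

theorem IsRowSpanning.isTotalDominatingSet {S : Finset V} (hS : G.IsRowSpanning μ S)
    (hG : G.Connected) (hcard : 2 ≤ S.card) (hconn : (G.induce (S : Set V)).Connected) :
    G.IsTotalDominatingSet S := by
  obtain ⟨a, -, b, -, hab⟩ := Finset.one_lt_card.mp hcard
  have : Nontrivial V := ⟨a, b, hab⟩
  intro v
  by_cases hv : v ∈ S
  · exact hconn.exists_adj_mem hcard hv
  · exact hS.isDominatingSet hG.preconnected.exists_adj_of_nontrivial v hv

/-! ### Private neighbours of a spanning set of rows -/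

namespace IsPrivateNeighbourMap

variable {S : Finset V} {p : V → V}

theorem shiftedAdj_eq_sum (hp : G.IsPrivateNeighbourMap S p) (hS : G.IsRowSpanning μ S)
    (v w : V) :
    G.shiftedAdj μ w v = ∑ s ∈ S, G.shiftedAdj μ s v * G.shiftedAdj μ w (p s) :=
  hS.shiftedAdj_eq_sum (fun _ hs _ ht => hp.shiftedAdj_eq hs ht) v w

/-- The diagonal of the identity `(A[S] - μ) (A[p S] - μ) = 1`. -/
theorem sum_eq_one (hp : G.IsPrivateNeighbourMap S p) (hS : G.IsRowSpanning μ S) {t : V}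
    (ht : t ∈ S) : ∑ s ∈ S, G.shiftedAdj μ s t * G.shiftedAdj μ (p t) (p s) = 1 := by
  rw [← hp.shiftedAdj_eq_sum hS, shiftedAdj_of_adj (hp.adj ht).symm]

/-- The off-diagonal entries of the identity `(A[S] - μ) (A[p S] - μ) = 1`. -/
theorem sum_eq_zero (hp : G.IsPrivateNeighbourMap S p) (hS : G.IsRowSpanning μ S) {t t' : V}
    (ht : t ∈ S) (ht' : t' ∈ S) (hne : t ≠ t') :
    ∑ s ∈ S, G.shiftedAdj μ s t * G.shiftedAdj μ (p t') (p s) = 0 := by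
  rw [← hp.shiftedAdj_eq_sum hS, shiftedAdj_comm, hp.shiftedAdj_eq ht' ht, if_neg hne]

/-- `μ ^ 2 + k = 1`, where `k` counts the edges at `t` in `S` that `p` preserves; so `k = 0`
unless `μ = 0`. -/
theorem not_adj_of_adj (hp : G.IsPrivateNeighbourMap S p) (hS : G.IsRowSpanning μ S)
    (hμ : μ ≠ 0) {s t : V} (hs : s ∈ S) (ht : t ∈ S) (hst : G.Adj s t) :
    ¬ G.Adj (p t) (p s) := by
  intro hadj
  have h := hp.sum_eq_one hS ht
  rw [← Finset.add_sum_erase S _ ht, shiftedAdj_self, shiftedAdj_self] at h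
  have hle := Finset.single_le_sum
    (f := fun s => G.shiftedAdj μ s t * G.shiftedAdj μ (p t) (p s)) (s := S.erase t)
    (fun x hx => hp.shiftedAdj_mul_nonneg (Finset.mem_of_mem_erase hx) ht
      (Finset.ne_of_mem_erase hx) (Finset.ne_of_mem_erase hx))
    (Finset.mem_erase.mpr ⟨hst.ne, hs⟩)
  simp only [shiftedAdj_of_adj hst, shiftedAdj_of_adj hadj] at hle
  have := mul_self_pos.mpr hμ
  nlinarith

theorem sq_eq_one (hp : G.IsPrivateNeighbourMap S p) (hS : G.IsRowSpanning μ S)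
    (hμ : μ ≠ 0) (hne : S.Nonempty) : μ ^ 2 = 1 := by
  obtain ⟨t, ht⟩ := hne
  have h := hp.sum_eq_one hS ht
  rw [← Finset.add_sum_erase S _ ht, shiftedAdj_self, shiftedAdj_self,
    Finset.sum_eq_zero] at h
  · nlinarith
  · intro s hs
    obtain ⟨hst, hs⟩ := Finset.mem_erase.mp hs
    by_cases hadj : G.Adj s t
    · rw [shiftedAdj_of_ne_of_not_adj (hp.ne ht hs hst.symm)
        (hp.not_adj_of_adj hS hμ hs ht hadj), mul_zero]
    · rw [shiftedAdj_of_ne_of_not_adj hst hadj, zero_mul]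

/-- For `t ≠ t'` in `S`, the number of `s ∈ S \ {t, t'}` with `s` adjacent to `t` and `p s` adjacent
to `p t'` is `μ` times the number of edges among the pairs `{t, t'}` and `{p t, p t'}`. -/
theorem sum_erase_eq (hp : G.IsPrivateNeighbourMap S p) (hS : G.IsRowSpanning μ S) {t t' : V}
    (ht : t ∈ S) (ht' : t' ∈ S) (hne : t ≠ t') :
    ∑ s ∈ (S.erase t).erase t', G.shiftedAdj μ s t * G.shiftedAdj μ (p t') (p s) =
      μ * (G.shiftedAdj μ (p t') (p t) + G.shiftedAdj μ t' t) := by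
  have h := hp.sum_eq_zero hS ht ht' hne
  rw [← Finset.add_sum_erase S _ ht, ← Finset.add_sum_erase (S.erase t) _
    (Finset.mem_erase.mpr ⟨hne.symm, ht'⟩), shiftedAdj_self, shiftedAdj_self] at h
  linarith

theorem ne_neg_one (hp : G.IsPrivateNeighbourMap S p) (hS : G.IsRowSpanning μ S) {t t' : V}
    (ht : t ∈ S) (ht' : t' ∈ S) (hadj : G.Adj t t') : μ ≠ -1 := by
  rintro rfl
  have h := hp.sum_erase_eq hS ht ht' hadj.ne
  have h0 : 0 ≤ ∑ s ∈ (S.erase t).erase t',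
      G.shiftedAdj (-1) s t * G.shiftedAdj (-1) (p t') (p s) := by
    refine Finset.sum_nonneg fun s hs => ?_
    simp only [Finset.mem_erase] at hs
    exact hp.shiftedAdj_mul_nonneg hs.2.2 ht' hs.2.1 hs.1
  have h1 := shiftedAdj_nonneg_of_ne (G := G) (μ := -1) (hp.ne ht' ht hadj.ne.symm)
  have h2 := shiftedAdj_of_adj (G := G) (μ := -1) hadj.symm
  linarith

/-- For `μ = 1`, exchanging two suitable vertices `s, t` of `S` for `p s` gives a smaller
dominating set. -/
theorem dominationNumber_lt (hp : G.IsPrivateNeighbourMap S p) (hS : G.IsRowSpanning 1 S)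
    (htot : G.IsTotalDominatingSet S) (hne : S.Nonempty) : G.dominationNumber < S.card := by
  obtain ⟨s, hs, t, ht, hst⟩ : ∃ s ∈ S, ∃ t ∈ S, G.Adj (p s) (p t) := by
    obtain ⟨t, ht⟩ := hne
    obtain ⟨t', ht', hadj⟩ := htot t
    by_contra! hcon
    have h := hp.sum_erase_eq hS ht ht' hadj.ne
    rw [shiftedAdj_of_adj hadj.symm, shiftedAdj_of_ne_of_not_adj
      (hp.ne ht' ht hadj.ne.symm) (hcon t' ht' t ht), Finset.sum_eq_zero] at h
    · norm_num at h
    · intro s hs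
      simp only [Finset.mem_erase] at hs
      rw [shiftedAdj_of_ne_of_not_adj (hp.ne ht' hs.2.2 (Ne.symm hs.1))
        (hcon t' ht' s hs.2.2), mul_zero]
  have hne : s ≠ t := fun h => hst.ne (congrArg p h)
  have hnadj : ¬ G.Adj s t := fun h => hp.not_adj_of_adj hS one_ne_zero hs ht h hst.symm
  -- The column of a vertex `v ∉ S` with all neighbours in `S` among `s, t` is a combination of
  -- those of `p s` and `p t`; comparing entries, `v` must be one of these two vertices.
  have hsupp : ∀ v, v ∉ S → (∀ x ∈ S, G.Adj x v → x = s ∨ x = t) → v = p s ∨ v = p t := by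
    intro v hv hnbr
    have hexp : ∀ w, G.shiftedAdj 1 w v = G.shiftedAdj 1 s v * G.shiftedAdj 1 w (p s) +
        G.shiftedAdj 1 t v * G.shiftedAdj 1 w (p t) := by
      intro w
      rw [hp.shiftedAdj_eq_sum hS v w, ← Finset.sum_pair
        (f := fun x => G.shiftedAdj 1 x v * G.shiftedAdj 1 w (p x)) hne]
      refine (Finset.sum_subset ?_ fun x hx hxst => ?_).symm
      · simp [Finset.insert_subset_iff, hs, ht]
      · have hxv : x ≠ v := fun h => hv (h ▸ hx)
        have hadj : ¬ G.Adj x v := fun hadj => hxst (by simpa using hnbr x hx hadj)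
        rw [shiftedAdj_of_ne_of_not_adj hxv hadj, zero_mul]
    have hv0 := hexp v
    have hvs := hexp (p s)
    have hvt := hexp (p t)
    rw [shiftedAdj_comm v (p s), shiftedAdj_comm v (p t), shiftedAdj_self] at hv0
    rw [shiftedAdj_self, shiftedAdj_of_adj hst] at hvs
    rw [shiftedAdj_self, shiftedAdj_of_adj hst.symm] at hvt
    by_contra! hcon
    have h1 := shiftedAdj_nonneg_of_ne (G := G) (μ := 1) hcon.1.symm
    have h2 := shiftedAdj_nonneg_of_ne (G := G) (μ := 1) hcon.2.symm
    -- Both values are nonnegative and opposite, so they vanish, and so does the diagonal entry.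
    have h3 : G.shiftedAdj 1 (p s) v = 0 := by linarith
    have h4 : G.shiftedAdj 1 (p t) v = 0 := by linarith
    rw [h3, h4] at hv0
    norm_num at hv0
  have hdom : G.IsDominatingSet (insert (p s) ((S.erase s).erase t)) := by
    intro v hv
    simp only [Finset.mem_insert, Finset.mem_erase, not_or, not_and] at hv
    by_cases hvs : v = s
    · exact ⟨p s, by simp, by rw [hvs]; exact hp.adj hs⟩
    by_cases hvt : v = t
    · obtain ⟨w, hw, htw⟩ := htot t
      refine ⟨w, ?_, hvt ▸ htw⟩
      simp only [Finset.mem_insert, Finset.mem_erase]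
      exact Or.inr ⟨htw.ne.symm, fun h => hnadj (h ▸ htw.symm), hw⟩
    have hvS : v ∉ S := hv.2 hvt hvs
    by_contra! hcon
    have hnbr : ∀ x ∈ S, G.Adj x v → x = s ∨ x = t := by
      intro x hx hxv
      by_contra! hxst
      exact hcon x (by simp [hxst.1, hxst.2, hx]) hxv.symm
    rcases hsupp v hvS hnbr with h | h
    · exact hv.1 h
    · exact hcon (p s) (by simp) (h ▸ hst.symm)
  have hle := dominationNumber_le hdom
  have hps : p s ∉ (S.erase s).erase t := fun h =>
    (hp s hs).1 (Finset.mem_of_mem_erase (Finset.mem_of_mem_erase h))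
  rw [Finset.card_insert_of_notMem hps, Finset.card_erase_of_mem
    (Finset.mem_erase.mpr ⟨hne.symm, ht⟩), Finset.card_erase_of_mem hs] at hle
  have : 1 < S.card := Finset.one_lt_card.mpr ⟨s, hs, t, ht, hne⟩
  omega

/-- For `μ = 0`, the matrices `A[S]` and `A[p S]` are nonnegative and mutually inverse, so `S`
induces a perfect matching; if `S` is connected, it is an edge. -/
theorem exists_eq_pair (hp : G.IsPrivateNeighbourMap S p) (hS : G.IsRowSpanning 0 S)
    (hconn : (G.induce (S : Set V)).Connected) : ∃ a b, S = {a, b} ∧ G.Adj a b := by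
  have hnonneg : ∀ x y : V, 0 ≤ G.shiftedAdj 0 x y := by
    intro x y
    rcases eq_or_ne x y with rfl | hne
    · simp [shiftedAdj_self]
    · exact shiftedAdj_nonneg_of_ne hne
  have hex : ∀ t ∈ S, ∃ s ∈ S, G.Adj s t ∧ G.Adj (p t) (p s) := by
    intro t ht
    obtain ⟨s, hs, h⟩ := Finset.exists_ne_zero_of_sum_ne_zero
      ((hp.sum_eq_one hS ht).trans_ne one_ne_zero)
    have hst : s ≠ t := by
      rintro rfl
      simp [shiftedAdj_self] at h
    exact ⟨s, hs, adj_of_shiftedAdj_ne_zero hst (left_ne_zero_of_mul h),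
      adj_of_shiftedAdj_ne_zero (hp.ne ht hs hst.symm) (right_ne_zero_of_mul h)⟩
  have huniq : ∀ s ∈ S, ∀ t ∈ S, ∀ t' ∈ S, G.Adj s t → G.Adj (p t') (p s) → t = t' := by
    intro s hs t ht t' ht' hst hadj
    by_contra hne
    have h := (Finset.sum_eq_zero_iff_of_nonneg (fun x _ => mul_nonneg (hnonneg _ _)
      (hnonneg _ _))).mp (hp.sum_eq_zero hS ht ht' hne) s hs
    simp [shiftedAdj_of_adj hst, shiftedAdj_of_adj hadj] at h
  have hunique : ∀ s ∈ S, ∀ t ∈ S, ∀ t' ∈ S, G.Adj s t → G.Adj s t' → t = t' := by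
    intro s hs t ht t' ht' hst hst'
    obtain ⟨w, hw, -, hadj⟩ := hex s hs
    rw [huniq s hs t ht w hw hst hadj.symm, huniq s hs t' ht' w hw hst' hadj.symm]
  obtain ⟨⟨a, ha⟩⟩ := hconn.nonempty
  obtain ⟨b, hb, hba, -⟩ := hex a ha
  refine ⟨a, b, Finset.Subset.antisymm (fun x hx => ?_) ?_, hba.symm⟩
  · have := hconn.preconnected.forall_of_adj (P := fun y => y.1 = a ∨ y.1 = b)
      (a := ⟨a, ha⟩) (Or.inl rfl) (fun u v huv hu => ?_) ⟨x, hx⟩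
    · simpa using this
    · have huv' : G.Adj u.1 v.1 := huv
      rcases hu with hu | hu <;> rw [hu] at huv'
      · exact Or.inr (hunique a ha v v.2 b hb huv' hba.symm)
      · exact Or.inl (hunique b hb v v.2 a ha huv' hba)
  · rw [Finset.insert_subset_iff, Finset.singleton_subset_iff]
    exact ⟨ha, hb⟩

/-- If the rows of two adjacent vertices `a, b` span the row space of `A`, every vertex is
adjacent to exactly one of `a, b`, and adjacency means being on different sides. -/
theorem adj_iff_of_pair {a b : V} (hp : G.IsPrivateNeighbourMap {a, b} p)
    (hS : G.IsRowSpanning 0 {a, b}) (hab : G.Adj a b)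
    (htot : G.IsTotalDominatingSet {a, b}) (u v : V) :
    G.Adj u v ↔ (G.Adj a u ↔ ¬ G.Adj a v) := by
  have hexp : ∀ v w, G.shiftedAdj 0 w v = G.shiftedAdj 0 a v * G.shiftedAdj 0 w (p a) +
      G.shiftedAdj 0 b v * G.shiftedAdj 0 w (p b) := fun v w => by
    rw [hp.shiftedAdj_eq_sum hS v w, Finset.sum_pair hab.ne]
  have hb : ∀ w, G.shiftedAdj 0 w b = G.shiftedAdj 0 w (p a) := fun w => by
    simpa [shiftedAdj_self, shiftedAdj_of_adj hab] using hexp b w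
  have ha : ∀ w, G.shiftedAdj 0 w a = G.shiftedAdj 0 w (p b) := fun w => by
    simpa [shiftedAdj_self, shiftedAdj_of_adj hab.symm] using hexp a w
  have hval : ∀ v w : V, G.shiftedAdj 0 v w = if G.Adj v w then 1 else 0 := fun v w => by
    simp [shiftedAdj]
  have hmain : ∀ v w : V, (if G.Adj w v then (1 : ℝ) else 0) =
      (if G.Adj a v then 1 else 0) * (if G.Adj b w then 1 else 0) +
      (if G.Adj b v then 1 else 0) * (if G.Adj a w then 1 else 0) := fun v w => by
    have h := hexp v w
    rw [← ha, ← hb, shiftedAdj_comm w a, shiftedAdj_comm w b] at h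
    simpa only [hval] using h
  have hside : ∀ v, G.Adj b v ↔ ¬ G.Adj a v := by
    intro v
    constructor
    · intro h1 h2
      have h := hmain v v
      norm_num [h1, h2] at h
    · intro h1
      obtain ⟨w, hw, hvw⟩ := htot v
      rcases Finset.mem_insert.mp hw with rfl | hw
      · exact absurd hvw.symm h1
      · exact Finset.mem_singleton.mp hw ▸ hvw.symm
  have h := hmain v u
  simp only [hside] at h
  by_cases h1 : G.Adj u v <;> by_cases h2 : G.Adj a u <;> by_cases h3 : G.Adj a v <;>
    simp [h1, h2, h3] at h ⊢

end IsPrivateNeighbourMap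

end Shifted

/-! ### The extremal graphs -/

theorem exists_iso_completeBipartiteGraph [Fintype V] {P : V → Prop}
    (h : ∀ u v, G.Adj u v ↔ (P u ↔ ¬ P v)) {r s : ℕ} (hr : Nat.card {v // P v} = r)
    (hs : Nat.card {v // ¬ P v} = s) :
    Nonempty (G ≃g completeBipartiteGraph (Fin r) (Fin s)) := by
  classical
  let e : V ≃ Fin r ⊕ Fin s := (Equiv.sumCompl P).symm.trans
    ((Finite.equivFinOfCardEq hr).sumCongr (Finite.equivFinOfCardEq hs))
  have hl : ∀ v, (e v).isLeft ↔ P v := by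
    intro v
    by_cases hv : P v
    · simp [e, hv]
    · simp [e, hv]
  have hR : ∀ v, (e v).isRight ↔ ¬ P v := by
    intro v
    rw [← hl]
    simp
  refine ⟨⟨e, fun {u v} => ?_⟩⟩
  simp only [completeBipartiteGraph, hl, hR, h]
  tauto

theorem nonempty_iso_completeGraph_iff {n : ℕ} [Fintype V] (hcard : Fintype.card V = n) :
    Nonempty (G ≃g completeGraph (Fin n)) ↔ G = ⊤ := by
  constructor
  · rintro ⟨e⟩
    ext u v
    rw [← e.map_adj_iff]
    simp
  · rintro rfl
    exact ⟨Iso.completeGraph (Fintype.equivFinOfCardEq hcard)⟩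

theorem two_le_dominationNumber_of_iso [Fintype V] {r s : ℕ} (hr : 2 ≤ r) (hs : 2 ≤ s)
    (e : G ≃g completeBipartiteGraph (Fin r) (Fin s)) : 2 ≤ G.dominationNumber := by
  have : Nonempty V := ⟨e.symm (Sum.inl ⟨0, by omega⟩)⟩
  have : Nontrivial (Fin r) := Fin.nontrivial_iff_two_le.mpr hr
  have : Nontrivial (Fin s) := Fin.nontrivial_iff_two_le.mpr hs
  refine two_le_dominationNumber fun v => ?_
  rcases hv : e v with i | j
  · obtain ⟨k, hk⟩ := exists_ne i
    refine ⟨e.symm (Sum.inl k), fun h => ?_, fun h => ?_⟩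
    · rw [← h] at hv
      exact hk (by simpa using hv)
    · rw [← e.map_adj_iff, hv] at h
      simp at h
  · obtain ⟨k, hk⟩ := exists_ne j
    refine ⟨e.symm (Sum.inr k), fun h => ?_, fun h => ?_⟩
    · rw [← h] at hv
      exact hk (by simpa using hv)
    · rw [← e.map_adj_iff, hv] at h
      simp at h

section Extremal

variable [Fintype V] [DecidableEq V] [DecidableRel G.Adj] {μ : ℝ}

theorem rank_shiftedAdj_neg_one_le_of_eq_top (h : G = ⊤) [Nonempty V] :
    (G.shiftedAdj (-1)).rank ≤ 1 := by
  have hone : ∀ u v : V, G.shiftedAdj (-1) u v = 1 := by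
    intro u v
    rcases eq_or_ne u v with rfl | hne
    · simp [shiftedAdj_self]
    · exact shiftedAdj_of_adj (by simpa [h] using hne)
  let a := Classical.arbitrary V
  have hS : G.IsRowSpanning (-1) {a} := fun v =>
    subset_span ⟨a, by simp, by ext w; simp [Matrix.row_apply, hone]⟩
  simpa using hS.rank_le

theorem rank_shiftedAdj_zero_le_of_iso {r s : ℕ} (hr : 2 ≤ r) (hs : 2 ≤ s)
    (e : G ≃g completeBipartiteGraph (Fin r) (Fin s)) : (G.shiftedAdj 0).rank ≤ 2 := by
  have hval : ∀ v w : V, G.shiftedAdj 0 v w = if G.Adj v w then 1 else 0 := fun v w => by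
    simp [shiftedAdj]
  let a := e.symm (Sum.inl ⟨0, by omega⟩)
  let b := e.symm (Sum.inr ⟨0, by omega⟩)
  have hS : G.IsRowSpanning 0 {a, b} := by
    intro v
    rcases hv : e v with i | j
    · refine subset_span ⟨a, by simp, ?_⟩
      ext w
      have hadj : G.Adj a w ↔ G.Adj v w := by
        rw [← e.map_adj_iff, ← e.map_adj_iff (v := v), hv]
        simp [a]
      simp only [Matrix.row_apply, hval, hadj]
    · refine subset_span ⟨b, by simp, ?_⟩
      ext w
      have hadj : G.Adj b w ↔ G.Adj v w := by
        rw [← e.map_adj_iff, ← e.map_adj_iff (v := v), hv]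
        simp [b]
      simp only [Matrix.row_apply, hval, hadj]
  exact hS.rank_le.trans Finset.card_le_two

/-- In a complete graph of order at least two, `A - μ I` has rank one only for `μ = -1`, and for
`μ = 1` if the order is two. -/
theorem eq_of_rank_eq_one (h : G = ⊤) (hn : 2 ≤ Fintype.card V)
    (hrank : (G.shiftedAdj μ).rank = 1) : μ = -1 ∨ μ = 1 ∧ Fintype.card V = 2 := by
  have hrow : ∀ a b : V, a ≠ b →
      (G.shiftedAdj μ).row b = (-μ) • (G.shiftedAdj μ).row a ∧ μ ^ 2 = 1 := by
    intro a b hne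
    refine row_eq_of_not_linearIndepOn_pair (by simpa [h] using hne) fun hind => ?_
    have := card_le_rank_of_linearIndepOn (S := {a, b}) (by simpa using hind)
    rw [Finset.card_pair hne] at this
    omega
  obtain ⟨a, b, hne⟩ := Fintype.exists_pair_of_one_lt_card (α := V) (by omega)
  rcases sq_eq_one_iff.mp (hrow a b hne).2 with rfl | rfl
  · right
    refine ⟨rfl, ?_⟩
    by_contra hcard
    obtain ⟨c, hca, hcb⟩ : ∃ c : V, c ≠ a ∧ c ≠ b := by
      by_contra! hcon
      have : (Finset.univ : Finset V) ⊆ {a, b} := fun x _ => by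
        by_cases hx : x = a
        · simp [hx]
        · simp [hcon x hx]
      have := (Finset.card_le_card this).trans Finset.card_le_two
      rw [Finset.card_univ] at this
      omega
    -- Three rows that are pairwise opposite vanish.
    have h1 := congrFun (hrow a b hne).1 b
    have h2 := congrFun (hrow b c hcb.symm).1 b
    have h3 := congrFun (hrow c a hca).1 b
    have h4 : G.shiftedAdj 1 b b = -1 := shiftedAdj_self b
    simp only [Pi.smul_apply, Matrix.row_apply, smul_eq_mul] at h1 h2 h3
    linarith
  · exact Or.inl rfl

/-- The equality case for graphs which are not complete. -/
theorem eq_zero_and_exists_iso_of_rank_le (hG : G.Connected) (htop : G ≠ ⊤)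
    (hrank : (G.shiftedAdj μ).rank ≤ G.dominationNumber) :
    μ = 0 ∧ ∃ r s : ℕ, 2 ≤ r ∧ 2 ≤ s ∧
      Nonempty (G ≃g completeBipartiteGraph (Fin r) (Fin s)) := by
  obtain ⟨S, hcard, hconn, hind, hS⟩ := exists_connected_row_basis hG htop μ
  have htot : G.IsTotalDominatingSet S := hS.isTotalDominatingSet hG hcard hconn
  have hle := card_le_rank_of_linearIndepOn hind
  obtain ⟨p, hp⟩ := htot.exists_isPrivateNeighbourMap (hle.trans hrank)
  have hne : S.Nonempty := Finset.card_pos.mp (by omega)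
  by_cases hμ : μ = 0
  · subst hμ
    refine ⟨rfl, ?_⟩
    obtain ⟨a, b, rfl, hab⟩ := hp.exists_eq_pair hS hconn
    have hadj := hp.adj_iff_of_pair hS hab htot
    have ha : a ∈ ({a, b} : Finset V) := by simp
    have hb : b ∈ ({a, b} : Finset V) := by simp
    refine ⟨_, _, ?_, ?_, exists_iso_completeBipartiteGraph hadj rfl rfl⟩
    · rw [Nat.card_eq_fintype_card]
      have : Nontrivial {v // G.Adj a v} :=
        ⟨⟨b, hab⟩, ⟨p a, hp.adj ha⟩, fun h =>
          (hp a ha).1 ((show b = p a from congrArg Subtype.val h) ▸ hb)⟩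
      exact Fintype.one_lt_card
    · rw [Nat.card_eq_fintype_card]
      have hpb : ¬ G.Adj a (p b) := fun h => hab.ne (((hp b hb).2 a ha).mp h)
      have : Nontrivial {v // ¬ G.Adj a v} :=
        ⟨⟨a, G.irrefl⟩, ⟨p b, hpb⟩, fun h =>
          (hp b hb).1 ((show a = p b from congrArg Subtype.val h) ▸ ha)⟩
      exact Fintype.one_lt_card
  · exfalso
    obtain ⟨t, ht⟩ := hne
    obtain ⟨t', ht', hadj⟩ := htot t
    rcases sq_eq_one_iff.mp (hp.sq_eq_one hS hμ ⟨t, ht⟩) with rfl | rfl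
    · have := hp.dominationNumber_lt hS htot ⟨t, ht⟩
      omega
    · exact hp.ne_neg_one hS ht ht' hadj rfl

end Extremal

end SimpleGraph

theorem mainTheorem1 {V : Type*} [Fintype V] [DecidableEq V] (G : SimpleGraph V)
    [DecidableRel G.Adj] (hconn : G.Connected) (hn : 2 ≤ Fintype.card V)
    (μ : ℝ) (hμ : G.IsAdjEigenvalue μ) :
    G.dominationNumber ≤ Fintype.card V - G.adjMultiplicity μ ∧
    (G.dominationNumber = Fintype.card V - G.adjMultiplicity μ ↔
      (μ = 1 ∧ Nonempty (G ≃g SimpleGraph.completeGraph (Fin 2))) ∨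
      (μ = -1 ∧ Nonempty (G ≃g SimpleGraph.completeGraph (Fin (Fintype.card V)))) ∨
      (μ = 0 ∧ ∃ r s : ℕ, 2 ≤ r ∧ 2 ≤ s ∧
        Nonempty (G ≃g completeBipartiteGraph (Fin r) (Fin s)))) ∧
    (¬ Nonempty (G ≃g SimpleGraph.completeGraph (Fin (Fintype.card V))) →
      G.totalDominationNumber ≤ ((Fintype.card V - G.adjMultiplicity μ : ℕ) : ℕ∞)) := by
  have hV : Nontrivial V := Fintype.one_lt_card_iff_nontrivial.mp hn
  have hmult : 1 ≤ G.adjMultiplicity μ := Submodule.one_le_finrank_iff.mpr hμ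
  have htotal : G ≠ ⊤ → ∃ S : Finset V, G.IsTotalDominatingSet S ∧
      S.card ≤ (G.shiftedAdj μ).rank := fun htop => by
    obtain ⟨S, hcard, hSconn, hind, hS⟩ := SimpleGraph.exists_connected_row_basis hconn htop μ
    exact ⟨S, hS.isTotalDominatingSet hconn hcard hSconn,
      SimpleGraph.card_le_rank_of_linearIndepOn hind⟩
  have hle : G.dominationNumber ≤ (G.shiftedAdj μ).rank := by
    by_cases htop : G = ⊤
    · obtain ⟨a⟩ := hconn.nonempty
      obtain ⟨b, hab⟩ := hconn.preconnected.exists_adj_of_nontrivial a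
      have h := SimpleGraph.card_le_rank_of_linearIndepOn (G := G) (μ := μ) (S := {a})
        (by simpa using (SimpleGraph.shiftedAdj_row_ne_zero hab))
      rw [SimpleGraph.dominationNumber_eq_one_of_eq_top htop]
      simpa using h
    · obtain ⟨S, hS, hcard⟩ := htotal htop
      exact (SimpleGraph.dominationNumber_le fun v _ => hS v).trans hcard
  have hrank := SimpleGraph.card_sub_adjMultiplicity (G := G) μ
  rw [SimpleGraph.nonempty_iso_completeGraph_iff rfl, hrank]
  refine ⟨hle, ⟨fun heq => ?_, ?_⟩, fun htop => ?_⟩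
  · by_cases htop : G = ⊤
    · rw [SimpleGraph.dominationNumber_eq_one_of_eq_top htop] at heq
      rcases SimpleGraph.eq_of_rank_eq_one htop hn heq.symm with h | ⟨h, hcard⟩
      · exact Or.inr (Or.inl ⟨h, htop⟩)
      · exact Or.inl ⟨h, (SimpleGraph.nonempty_iso_completeGraph_iff hcard).mpr htop⟩
    · exact Or.inr (Or.inr
        (SimpleGraph.eq_zero_and_exists_iso_of_rank_le hconn htop heq.ge))
  · rintro (⟨-, ⟨e⟩⟩ | ⟨rfl, htop⟩ | ⟨rfl, r, s, hr, hs, ⟨e⟩⟩)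
    · have hcard : Fintype.card V = 2 := by simpa using Fintype.card_congr e.toEquiv
      have := SimpleGraph.dominationNumber_pos (G := G)
      omega
    · exact le_antisymm hle ((SimpleGraph.rank_shiftedAdj_neg_one_le_of_eq_top htop).trans
        SimpleGraph.dominationNumber_pos)
    · exact le_antisymm hle ((SimpleGraph.rank_shiftedAdj_zero_le_of_iso hr hs e).trans
        (SimpleGraph.two_le_dominationNumber_of_iso hr hs e))
  · obtain ⟨S, hS, hcard⟩ := htotal htop
    exact (SimpleGraph.totalDominationNumber_le hS).trans (by exact_mod_cast hcard)
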